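/- Fix $p\ge 1$ and a positive definite $\Sigma_0\in\mathbb{R}^{p\times p}$, let $\Theta_0=\Sigma_0^{-1}$, and let $X_1,X_2,\dots$ be i.i.d. $\mathcal N(0,\Sigma_0)$ random vectors; $X\in\mathbb{R}^{n\times p}$ is the data matrix with rows $X_1,\dots,X_n$ and columns $x_1,\dots,x_p$. Identify $\nu=\mathrm{vec}(U)\in\mathbb{R}^{p^2}$ with the pair $(\Phi,R)$, where $R=\mathrm{diag}(\rho_1,\dots,\rho_p)$ is the diagonal part of $U$ and $\Phi=(\varphi_{ij})=[\varphi_1|\cdots|\varphi_p]$ its off-diagonal part. The DAG space $\mathcal D$ is the set of $\nu$ such that all $\rho_j>0$ and the directed graph with an edge $i\to j$ whenever $\varphi_{ij}\ne0$ has no directed cycle. For $\nu\in\mathcal D$ let $\Theta(\nu)=(R-\Phi)(R-\Phi)^T$, and let $\mathcal E_0=\{\nu\in\mathcal D:\Theta(\nu)=\Theta_0\}$. Let $p_\lambda:[0,\infty)\to[0,\infty)$ be nondecreasing, lower semicontinuous (for instance continuous) penalty functions indexed by a tuning parameter $\lambda$, let $(\lambda_n)$ be a sequence of tuning parameters, and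 let $$F(\nu)=\sum_{j=1}^p\Big[n\log\rho_j-\tfrac12\|\rho_jx_j-X\varphi_j\|^2\Big]-n\sum_{i\ne j}p_{\lambda_n}(|\varphi_{ij}|),\qquad \nu\in\mathcal D .$$ For $\nu_0=(\Phi_0,R_0)\in\mathcal E_0$ put $a_n(\nu_0)=\max\{|p'_{\lambda_n}(|\varphi^0_{ij}|)|:\varphi^0_{ij}\ne0\}$ and $b_n(\nu_0)=\max\{|p''_{\lambda_n}(|\varphi^0_{ij}|)|:\varphi^0_{ij}\ne0\}$ (both $0$ if $\Phi_0=0$). Suppose that $\nu_0\in\mathcal E_0$ satisfies $b_n(\nu_0)\to0$, and that for each $\varphi^0_{ij}\neq 0$ the penalties $p_{\lambda_n}$ are, for all large $n$, twice differentiable on a neighbourhood of $|\varphi^0_{ij}|$ that does not depend on $n$, with $p''_{\lambda_n}(t)-p''_{\lambda_n}(|\varphi^0_{ij}|)\to0$ as $n\to\infty$ and $t\to|\varphi^0_{ij}|$. Then there are estimators $\widehat\nu_n$ (measurable functions of $X$) such that the probability that $\widehat\nu_n$ is a local maximizer of $F$ over $\mathcal D$ tends to $1$ and $$\|\widehat\nu_n-\nu_0\|=O_P\big(n^{-1/2}+a_n(\nu_0)\big),$$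 where $\|\cdot\|$ is the Euclidean norm on $\mathbb{R}^{p^2}$. -/

import Mathlib

open MeasureTheory ProbabilityTheory Filter Topology

namespace GaussianDAG

noncomputable section

/-- The parameter space `ℝ^(p²)` with its Euclidean norm: the vector `ν = vec(U)` lists the entries
of the `p × p` matrix `U = R + Φ`, i.e. `ν (i, j) = u_ij`. -/
abbrev Param (p : ℕ) : Type := EuclideanSpace ℝ (Fin p × Fin p)

/-- The weighted adjacency matrix `Φ = (φ_ij)` of `ν`: the off-diagonal part of `U`. -/
def adj {p : ℕ} (ν : Param p) : Matrix (Fin p) (Fin p) ℝ :=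
  Matrix.of fun i j => if i = j then 0 else ν (i, j)

/-- The reciprocal standard deviations `ρ_j`: the diagonal of `U`. -/
def rho {p : ℕ} (ν : Param p) (j : Fin p) : ℝ := ν (j, j)

/-- `vec` of a matrix. -/
def vec {p : ℕ} (U : Matrix (Fin p) (Fin p) ℝ) : Param p :=
  WithLp.toLp 2 fun ij : Fin p × Fin p => U ij.1 ij.2

/-- Every parameter is `vec(R + Φ)` for its own `R` and `Φ`. -/
theorem vec_diagonal_add_adj {p : ℕ} (ν : Param p) :
    vec (Matrix.diagonal (rho ν) + adj ν) = ν := by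
  ext ⟨i, j⟩
  by_cases h : i = j
  · subst h; simp [vec, adj, rho]
  · simp [vec, adj, h]

/-- A weighted adjacency matrix is a DAG if the directed graph with an edge `k → l` whenever
`A k l ≠ 0` has no directed cycle (no vertex can be reached from itself by a path of length at
least one; in particular the diagonal vanishes). -/
def IsDAG {p : ℕ} (A : Matrix (Fin p) (Fin p) ℝ) : Prop :=
  ∀ i, ¬ Relation.TransGen (fun k l => A k l ≠ 0) i i

/-- The DAG space `𝒟`. -/
def dagSpace (p : ℕ) : Set (Param p) :=
  {ν | IsDAG (adj ν) ∧ ∀ j, 0 < rho ν j}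

/-- The inverse covariance matrix `Θ(ν) = (R - Φ)(R - Φ)ᵀ`. -/
def invCov {p : ℕ} (ν : Param p) : Matrix (Fin p) (Fin p) ℝ :=
  (Matrix.diagonal (rho ν) - adj ν) * (Matrix.diagonal (rho ν) - adj ν).transpose

/-- The equivalence class `ℰ(Θ)` of all DAGs with inverse covariance matrix `Θ`. -/
def equivClass {p : ℕ} (Θ : Matrix (Fin p) (Fin p) ℝ) : Set (Param p) :=
  {ν | ν ∈ dagSpace p ∧ invCov ν = Θ}

/-- The Gaussian log-likelihood (without its additive constant) of the `n × p` data matrix `x`,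
`ℓ_n(ν | x) = ∑_j (n log ρ_j - ‖ρ_j x_j - x φ_j‖² / 2)`. -/
def logLik {p : ℕ} (n : ℕ) (x : Matrix (Fin n) (Fin p) ℝ) (ν : Param p) : ℝ :=
  ∑ j, ((n : ℝ) * Real.log (rho ν j)
    - (1 / 2) * ∑ k, (rho ν j * x k j - (x * adj ν) k j) ^ 2)

/-- The penalty `∑_{i ≠ j} p_λ(|u_ij|)`, with the scalar penalty function `pen = p_λ`. -/
def penalty {p : ℕ} (pen : ℝ → ℝ) (ν : Param p) : ℝ :=
  ∑ i, ∑ j, if i = j then 0 else pen |ν (i, j)|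

/-- The penalized log-likelihood `F(ν) = ℓ_n(ν | x) - n p_λ(ν)`. -/
def penLogLik {p : ℕ} (pen : ℝ → ℝ) (n : ℕ) (x : Matrix (Fin n) (Fin p) ℝ) (ν : Param p) : ℝ :=
  logLik n x ν - (n : ℝ) * penalty pen ν

/-- `ν` is a local maximizer over the DAG space of the penalized log-likelihood. -/
def IsLocalMaximizer {p : ℕ} (pen : ℝ → ℝ) (n : ℕ) (x : Matrix (Fin n) (Fin p) ℝ)
    (ν : Param p) : Prop :=
  ν ∈ dagSpace p ∧ IsLocalMaxOn (penLogLik pen n x) (dagSpace p) ν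

/-- The edges of `ν`: the positions of the nonzero coefficients `φ_ij`. -/
abbrev Edge {p : ℕ} (ν : Param p) : Type :=
  {ij : Fin p × Fin p // adj ν ij.1 ij.2 ≠ 0}

/-- The largest penalty slope `max {|p_λ'(|φ_ij|)| : φ_ij ≠ 0}`, which is `0` without edges. -/
def maxSlope {p : ℕ} (pen : ℝ → ℝ) (ν : Param p) : ℝ :=
  ⨆ e : Edge ν, abs (deriv pen |adj ν e.1.1 e.1.2|)

/-- The largest penalty curvature `max {|p_λ''(|φ_ij|)| : φ_ij ≠ 0}`, which is `0` without edges. -/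
def maxCurvature {p : ℕ} (pen : ℝ → ℝ) (ν : Param p) : ℝ :=
  ⨆ e : Edge ν, abs (deriv (deriv pen) |adj ν e.1.1 e.1.2|)

/-- Along the sequence `q n`, second derivatives exist near `t₀` and are equicontinuous at `t₀`,
asymptotically in `n`: there are `N` and a neighbourhood of `t₀` on which `q n` is twice
differentiable for `n ≥ N`, and `(q n)''(t) - (q n)''(t₀) → 0` as `n → ∞` and `t → t₀`. -/
def EquiC2At (q : ℕ → ℝ → ℝ) (t₀ : ℝ) : Prop :=
  (∀ᶠ z : ℕ × ℝ in atTop ×ˢ 𝓝 t₀,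
      DifferentiableAt ℝ (q z.1) z.2 ∧ DifferentiableAt ℝ (deriv (q z.1)) z.2) ∧
    Tendsto (fun z : ℕ × ℝ => deriv (deriv (q z.1)) z.2 - deriv (deriv (q z.1)) t₀)
      (atTop ×ˢ 𝓝 t₀) (𝓝 0)

/-- `‖Y n‖ = O_P(r n)`: for every `ε > 0` there is `C > 0` with `P(‖Y n‖ > C * r n) ≤ ε` for all
large `n`. (`P` is the outer measure on events that are not measurable.) -/
def IsBigOP {Ω E : Type*} [MeasurableSpace Ω] [Norm E] (P : Measure Ω)
    (Y : ℕ → Ω → E) (r : ℕ → ℝ) : Prop :=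
  ∀ ε : ℝ, 0 < ε → ∃ C : ℝ, 0 < C ∧ ∀ᶠ n in atTop,
    P {ω | C * r n < ‖Y n ω‖} ≤ ENNReal.ofReal ε

/-- The `n × p` data matrix whose rows are the first `n` observations. -/
def dataMatrix {p : ℕ} {Ω : Type*} (X : ℕ → Ω → EuclideanSpace ℝ (Fin p)) (n : ℕ) (ω : Ω) :
    Matrix (Fin n) (Fin p) ℝ :=
  Matrix.of fun k j => X k ω j

end

end GaussianDAG

open GaussianDAG

/-!
The log-likelihood `∑_j log ρ_j - tr((R - Φ)ᵀ S (R - Φ)) / 2`, with `S = XᵀX / n`, is concave in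
`ν`. Along every DAG `ν` which contains the edges of `ν₀`, its derivative at `ν₀` vanishes when `S`
is the true covariance matrix `Σ₀`, because `(R₀ - Φ₀)⁻¹ = (R₀ - Φ₀)ᵀ Σ₀` and `R - Φ` are
triangular in a common order (`trace_transpose_mul_mul_eq_sum_div`). All DAGs close to `ν₀`
contain the edges of `ν₀`. So in a fixed neighbourhood of `ν₀` the likelihood gains over `ν₀` at
most `O(‖S - Σ₀‖) ‖ν - ν₀‖ - κ ‖ν - ν₀‖²` (`gaussObj_sub_le`). The penalty loses at most
`O(a_n) ‖ν - ν₀‖ + o(1) ‖ν - ν₀‖²`, because it is monotone at the coefficients that vanish in `ν₀`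
and has a second-order expansion at the others (`eventually_penalty_sub_le`). Hence a maximizer
over this neighbourhood is at distance `O(‖S - Σ₀‖ + a_n)` from `ν₀`
(`exists_norm_sub_le_of_le`), and is a local maximizer over the DAG space if this is smaller than
the radius.

The slopes `a_n` need not tend to zero. For those `n` for which `a_n` exceeds a fixed threshold, a
bounded error is of order `a_n`, and a global maximizer serves. It lies in a fixed compact set
whenever `S` is near `Σ₀`: the likelihood is coercive, and no penalty is smaller than that of the
empty graph (`exists_dagBox_gaussObj_le`, `penalty_vec_one_le`).

In both cases the estimator maximizes an upper semicontinuous function over a compact set, and a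
measurable choice of the maximizer comes from a selection theorem for compact-valued maps
(`exists_measurable_isMaxOn`). The rate follows from Chebyshev's inequality for the entries of
`S` (`exists_measure_sampleCov_sub_le`).
-/

/-! ### Measurable selection -/

/-- The refinement step for measurable selection: a compact-valued map `A` whose hitting sets of
closed sets are measurable can be cut down, by closed balls of any given radius with measurably
chosen centres, to a map with the same property. -/
theorem exists_measurable_centre {α β : Type*} [MeasurableSpace α] [PseudoMetricSpace β]
    [TopologicalSpace.SeparableSpace β] [Nonempty β] [MeasurableSpace β] (A : α → Set β)
    (hne : ∀ x, (A x).Nonempty)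
    (hmeas : ∀ C, IsClosed C → MeasurableSet {x | (A x ∩ C).Nonempty}) {r : ℝ} (hr : 0 < r) :
    ∃ c : α → β, Measurable c ∧ (∀ x, (A x ∩ Metric.closedBall (c x) r).Nonempty) ∧
      ∀ C, IsClosed C →
        MeasurableSet {x | (A x ∩ Metric.closedBall (c x) r ∩ C).Nonempty} := by
  classical
  let d := TopologicalSpace.denseSeq β
  have hex : ∀ x, ∃ k, (A x ∩ Metric.closedBall (d k) r).Nonempty := by
    intro x
    obtain ⟨y, hy⟩ := hne x
    obtain ⟨k, hk⟩ := (TopologicalSpace.denseRange_denseSeq β).exists_dist_lt y hr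
    exact ⟨k, y, hy, hk.le⟩
  have hN : Measurable fun x => Nat.find (hex x) :=
    measurable_find hex fun k => hmeas _ Metric.isClosed_closedBall
  refine ⟨fun x => d (Nat.find (hex x)), measurable_from_nat.comp hN,
    fun x => Nat.find_spec (hex x), fun C hC => ?_⟩
  have : {x | (A x ∩ Metric.closedBall (d (Nat.find (hex x))) r ∩ C).Nonempty} =
      ⋃ k, ((fun x => Nat.find (hex x)) ⁻¹' {k}) ∩
        {x | (A x ∩ (Metric.closedBall (d k) r ∩ C)).Nonempty} := by
    ext x
    simp [Set.inter_assoc]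
  rw [this]
  exact MeasurableSet.iUnion fun k => (hN (measurableSet_singleton k)).inter
    (hmeas _ (Metric.isClosed_closedBall.inter hC))

/-- Measurable selection for compact-valued maps (a case of the theorem of Kuratowski and
Ryll-Nardzewski): successive refinement by balls of radius `1 / (k + 1)` singles out a point
which is the limit of the measurably chosen centres. -/
theorem exists_measurable_selection {α β : Type*} [MeasurableSpace α] [MetricSpace β]
    [TopologicalSpace.SeparableSpace β] [Nonempty β] [MeasurableSpace β] [BorelSpace β] (A : α → Set β)
    (hne : ∀ x, (A x).Nonempty) (hcpt : ∀ x, IsCompact (A x))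
    (hmeas : ∀ C, IsClosed C → MeasurableSet {x | (A x ∩ C).Nonempty}) :
    ∃ f : α → β, Measurable f ∧ ∀ x, f x ∈ A x := by
  let T := {A : α → Set β // (∀ x, (A x).Nonempty) ∧
    ∀ C, IsClosed C → MeasurableSet {x | (A x ∩ C).Nonempty}}
  have hr : ∀ k : ℕ, (0 : ℝ) < 1 / ((k : ℝ) + 1) := fun k => Nat.one_div_pos_of_nat
  choose c hcm hcne hcmeas using fun (k : ℕ) (B : T) =>
    exists_measurable_centre B.1 B.2.1 B.2.2 (hr k)
  let S : ℕ → T := fun k => Nat.rec ⟨A, hne, hmeas⟩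
    (fun k B => ⟨fun x => B.1 x ∩ Metric.closedBall (c k B x) (1 / ((k : ℝ) + 1)),
      hcne k B, hcmeas k B⟩) k
  have hS0 : (S 0).1 = A := rfl
  have hSs : ∀ k x, (S (k + 1)).1 x =
      (S k).1 x ∩ Metric.closedBall (c k (S k) x) (1 / ((k : ℝ) + 1)) := fun _ _ => rfl
  have hScl : ∀ x k, IsClosed ((S k).1 x) := by
    intro x k
    induction k with
    | zero => exact (hcpt x).isClosed
    | succ k ih => rw [hSs]; exact ih.inter Metric.isClosed_closedBall
  have hpt : ∀ x, (⋂ k, (S k).1 x).Nonempty := fun x =>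
    IsCompact.nonempty_iInter_of_sequence_nonempty_isCompact_isClosed _
      (fun k => by rw [hSs]; exact Set.inter_subset_left) (fun k => (S k).2.1 x) (hcpt x)
      (hScl x)
  choose f hf using hpt
  have hf' : ∀ x k, f x ∈ (S k).1 x := fun x => Set.mem_iInter.1 (hf x)
  refine ⟨f, measurable_of_tendsto_metrizable (f := fun k x => c k (S k) x)
    (fun k => hcm k (S k)) (tendsto_pi_nhds.2 fun x => ?_), fun x => hf' x 0⟩
  rw [tendsto_iff_dist_tendsto_zero]
  refine squeeze_zero (fun _ => dist_nonneg) (fun k => ?_) tendsto_one_div_add_atTop_nhds_zero_nat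
  rw [dist_comm]
  exact ((hSs k x) ▸ hf' x (k + 1)).2

/-- A maximizer over a compact set can be chosen measurably in a parameter in which the objective
is continuous. Whether the set of maximizers meets a closed set `C` is a comparison of two
suprema of continuous functions of the parameter, namely over `K` and over `K ∩ C`. The suprema
are taken in `EReal`, where they exist unconditionally. -/
theorem exists_measurable_isMaxOn {α β : Type*} [TopologicalSpace α] [MeasurableSpace α]
    [OpensMeasurableSpace α] [MetricSpace β] [TopologicalSpace.SeparableSpace β] [MeasurableSpace β]
    [BorelSpace β] {K : Set β} (hK : IsCompact K) (hKne : K.Nonempty) (f : α → β → ℝ)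
    (hcont : ∀ y ∈ K, Continuous fun x => f x y) (husc : ∀ x, UpperSemicontinuousOn (f x) K) :
    ∃ g : α → β, Measurable g ∧ ∀ x, g x ∈ K ∧ IsMaxOn (f x) K (g x) := by
  have : Nonempty β := hKne.to_type
  let M : Set β → α → EReal := fun C x => ⨆ y, ⨆ (_ : y ∈ K ∩ C), ((f x y : ℝ) : EReal)
  have hM : ∀ C, Measurable (M C) := fun C =>
    (lowerSemicontinuous_biSup fun y hy =>
      (continuous_coe_real_ereal.comp (hcont y hy.1)).lowerSemicontinuous).measurable
  refine exists_measurable_selection (fun x => {y | y ∈ K ∧ IsMaxOn (f x) K y})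
    (fun x => (husc x).exists_isMaxOn hKne hK) (fun x => ?_) (fun C hC => ?_)
  · obtain ⟨m, hmK, hm⟩ := (husc x).exists_isMaxOn hKne hK
    obtain ⟨v, hv, hKv⟩ := upperSemicontinuousOn_iff_preimage_Ici.1 (husc x) (f x m)
    have : {y | y ∈ K ∧ IsMaxOn (f x) K y} = K ∩ v := by
      rw [← hKv]
      ext y
      refine and_congr_right fun hy => ⟨fun h => h hmK, fun h z hz => ?_⟩
      exact (show f x z ≤ f x m from hm hz).trans h
    rw [this]
    exact hK.inter_right hv
  · have : {x | ({y | y ∈ K ∧ IsMaxOn (f x) K y} ∩ C).Nonempty} =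
        {x | M Set.univ x ≤ M C x} := by
      ext x
      constructor
      · rintro ⟨y, ⟨hyK, hy⟩, hyC⟩
        refine (iSup₂_le fun z hz => ?_).trans
          (le_iSup₂ (f := fun y (_ : y ∈ K ∩ C) => ((f x y : ℝ) : EReal)) y ⟨hyK, hyC⟩)
        exact EReal.coe_le_coe_iff.2 (hy hz.1)
      · intro h
        have hne : (K ∩ C).Nonempty := by
          obtain ⟨y, hy⟩ := hKne
          by_contra hemp
          have h1 : ((f x y : ℝ) : EReal) ≤ M C x :=
            (le_iSup₂ (f := fun y (_ : y ∈ K ∩ Set.univ) => ((f x y : ℝ) : EReal)) y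
              ⟨hy, trivial⟩).trans h
          have h2 : M C x = ⊥ := by
            simp only [M, Set.not_nonempty_iff_eq_empty.1 hemp]
            simp
          rw [h2] at h1
          exact EReal.coe_ne_bot _ (le_bot_iff.1 h1)
        obtain ⟨m, hm, hmax⟩ := ((husc x).mono Set.inter_subset_left).exists_isMaxOn hne
          (hK.inter_right hC)
        refine ⟨m, ⟨hm.1, fun z hz => ?_⟩, hm.2⟩
        have h1 : ((f x z : ℝ) : EReal) ≤ M C x :=
          (le_iSup₂ (f := fun y (_ : y ∈ K ∩ Set.univ) => ((f x y : ℝ) : EReal)) z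
            ⟨hz, trivial⟩).trans h
        have h2 : M C x ≤ ((f x m : ℝ) : EReal) :=
          iSup₂_le fun z hz => EReal.coe_le_coe_iff.2 (hmax hz)
        exact EReal.coe_le_coe_iff.1 (h1.trans h2)
    rw [this]
    exact measurableSet_le (hM _) (hM _)

/-! ### The sample second-moment matrix -/

/-- The sample second-moment matrix `XᵀX / n` of the data matrix `x`. -/
noncomputable def sampleCov {p n : ℕ} (x : Matrix (Fin n) (Fin p) ℝ) : Matrix (Fin p) (Fin p) ℝ :=
  (n : ℝ)⁻¹ • (x.transpose * x)

theorem sampleCov_dataMatrix_apply {p : ℕ} {Ω : Type*} (X : ℕ → Ω → EuclideanSpace ℝ (Fin p))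
    (n : ℕ) (ω : Ω) (i j : Fin p) :
    sampleCov (dataMatrix X n ω) i j = (n : ℝ)⁻¹ * ∑ k ∈ Finset.range n, X k ω i * X k ω j := by
  simp [sampleCov, dataMatrix, Matrix.mul_apply, Finset.sum_range]

theorem memLp_eval_mul_eval_multivariateGaussian {p : ℕ} (Sigma₀ : Matrix (Fin p) (Fin p) ℝ)
    (i j : Fin p) :
    MemLp (fun x : EuclideanSpace ℝ (Fin p) => x i * x j) 2 (multivariateGaussian 0 Sigma₀) := by
  have h : ∀ i : Fin p, MemLp (fun x : EuclideanSpace ℝ (Fin p) => x i) 4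
      (multivariateGaussian 0 Sigma₀) := fun i =>
    IsGaussian.memLp_dual _ (EuclideanSpace.proj i) 4 (by simp)
  have : ENNReal.HolderTriple 4 4 2 := ⟨by
    rw [← two_mul, show (4 : ENNReal) = 2 * 2 by norm_num, ENNReal.mul_inv (by simp) (by simp),
      ← mul_assoc, ENNReal.mul_inv_cancel (by simp) (by simp), one_mul]⟩
  exact (h j).mul (h i)

theorem integral_eval_mul_eval_multivariateGaussian {p : ℕ}
    {Sigma₀ : Matrix (Fin p) (Fin p) ℝ} (hSigma : Sigma₀.PosSemidef) (i j : Fin p) :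
    ∫ x, x i * x j ∂(multivariateGaussian 0 Sigma₀) = Sigma₀ i j := by
  have h2 : ∀ i : Fin p, MemLp (fun x : EuclideanSpace ℝ (Fin p) => x i) 2
      (multivariateGaussian 0 Sigma₀) := fun i =>
    IsGaussian.memLp_dual _ (EuclideanSpace.proj i) 2 (by simp)
  have h0 : ∀ i : Fin p, ∫ x, x i ∂(multivariateGaussian 0 Sigma₀) = 0 := fun i => by
    have := (EuclideanSpace.proj (𝕜 := ℝ) i).integral_comp_id_comm
      (μ := multivariateGaussian 0 Sigma₀) IsGaussian.integrable_id
    simpa using this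
  rw [← covariance_eval_multivariateGaussian (μ := 0) hSigma i j, covariance_eq_sub (h2 i) (h2 j)]
  simp [h0]

/-- Chebyshev's inequality for the entries of the sample second-moment matrix. -/
theorem exists_measure_sampleCov_sub_le {p : ℕ} {Sigma₀ : Matrix (Fin p) (Fin p) ℝ}
    (hSigma : Sigma₀.PosSemidef) {Ω : Type*} [MeasurableSpace Ω] (P : Measure Ω)
    [IsProbabilityMeasure P] (X : ℕ → Ω → EuclideanSpace ℝ (Fin p))
    (hlaw : ∀ k, HasLaw (X k) (multivariateGaussian 0 Sigma₀) P) (hindep : iIndepFun X P) :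
    ∃ V : ℝ, 0 ≤ V ∧ ∀ n : ℕ, 0 < n → ∀ c : ℝ, 0 < c →
      P {ω | ∃ i j, c ≤ |sampleCov (dataMatrix X n ω) i j - Sigma₀ i j|} ≤
        ENNReal.ofReal (V / (n * c ^ 2)) := by
  let v : Fin p → Fin p → ℝ := fun i j =>
    Var[fun x : EuclideanSpace ℝ (Fin p) => x i * x j; multivariateGaussian 0 Sigma₀]
  have hv : ∀ i j, 0 ≤ v i j := fun i j => variance_nonneg _ _
  refine ⟨∑ i, ∑ j, v i j, Finset.sum_nonneg fun i _ => Finset.sum_nonneg fun j _ => hv i j,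
    fun n hn c hc => ?_⟩
  have hn' : (0 : ℝ) < n := Nat.cast_pos.2 hn
  have hmeas : ∀ i j : Fin p, Measurable fun x : EuclideanSpace ℝ (Fin p) => x i * x j :=
    fun i j => by fun_prop
  have key : ∀ i j, P {ω | c ≤ |sampleCov (dataMatrix X n ω) i j - Sigma₀ i j|} ≤
      ENNReal.ofReal (v i j / (n * c ^ 2)) := by
    intro i j
    let Y : ℕ → Ω → ℝ := fun k ω => X k ω i * X k ω j
    have hY2 : ∀ k, MemLp (Y k) 2 P := fun k => by
      have h := memLp_eval_mul_eval_multivariateGaussian Sigma₀ i j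
      rw [← (hlaw k).map_eq] at h
      exact h.comp_of_map (hlaw k).aemeasurable
    have hYint : ∀ k, ∫ ω, Y k ω ∂P = Sigma₀ i j := fun k => by
      rw [← integral_eval_mul_eval_multivariateGaussian hSigma i j]
      exact (hlaw k).integral_comp (hmeas i j).aestronglyMeasurable
    have hYvar : ∀ k, Var[Y k; P] = v i j := fun k => by
      simp only [v, ← (hlaw k).map_eq]
      rw [variance_map (hmeas i j).aemeasurable (hlaw k).aemeasurable]
      rfl
    have hYind : iIndepFun Y P :=
      hindep.comp (fun _ x => x i * x j) fun _ => hmeas i j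
    have hsum : MemLp (∑ k ∈ Finset.range n, Y k) 2 P := memLp_finsetSum' _ fun k _ => hY2 k
    have hvar : Var[∑ k ∈ Finset.range n, Y k; P] = n * v i j := by
      rw [IndepFun.variance_sum (fun k _ => hY2 k)
        fun k _ l _ hkl => hYind.indepFun hkl]
      simp [hYvar]
    have hint : ∫ ω, (∑ k ∈ Finset.range n, Y k) ω ∂P = n * Sigma₀ i j := by
      simp only [Finset.sum_apply]
      rw [integral_finsetSum _ fun k _ => (hY2 k).integrable (by norm_num)]
      simp [hYint]
    have hch := meas_ge_le_variance_div_sq hsum (mul_pos hn' hc)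
    rw [hvar, hint] at hch
    convert hch using 2
    · ext ω
      have : sampleCov (dataMatrix X n ω) i j - Sigma₀ i j =
          ((∑ k ∈ Finset.range n, Y k) ω - n * Sigma₀ i j) / n := by
        rw [sampleCov_dataMatrix_apply, Finset.sum_apply]
        field_simp
        rfl
      simp only [Set.mem_ofPred_eq]
      rw [this, abs_div, abs_of_pos hn', le_div_iff₀ hn', mul_comm]
    · field_simp
  calc P {ω | ∃ i j, c ≤ |sampleCov (dataMatrix X n ω) i j - Sigma₀ i j|}
      ≤ P (⋃ i, ⋃ j, {ω | c ≤ |sampleCov (dataMatrix X n ω) i j - Sigma₀ i j|}) := by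
        refine measure_mono fun ω hω => ?_
        simpa using hω
    _ ≤ ∑ i, ∑ j, P {ω | c ≤ |sampleCov (dataMatrix X n ω) i j - Sigma₀ i j|} :=
        (measure_iUnion_fintype_le _ _).trans
          (Finset.sum_le_sum fun i _ => measure_iUnion_fintype_le _ _)
    _ ≤ ∑ i, ∑ j, ENNReal.ofReal (v i j / (n * c ^ 2)) :=
        Finset.sum_le_sum fun i _ => Finset.sum_le_sum fun j _ => key i j
    _ = ENNReal.ofReal ((∑ i, ∑ j, v i j) / (n * c ^ 2)) := by
        have h0 : ∀ i j, 0 ≤ v i j / (n * c ^ 2) := fun i j => div_nonneg (hv i j) (by positivity)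
        rw [Finset.sum_div, ENNReal.ofReal_sum_of_nonneg fun i _ => by
          rw [Finset.sum_div]; exact Finset.sum_nonneg fun j _ => h0 i j]
        refine Finset.sum_congr rfl fun i _ => ?_
        rw [Finset.sum_div, ENNReal.ofReal_sum_of_nonneg fun j _ => h0 i j]

/-! ### The Gaussian objective as a function of the second-moment matrix -/

/-- The coefficient matrix `R - Φ` of `ν`. It is linear in `ν`. -/
noncomputable def coeffMat {p : ℕ} (ν : Param p) : Matrix (Fin p) (Fin p) ℝ :=
  Matrix.diagonal (rho ν) - adj ν

theorem coeffMat_apply {p : ℕ} (ν : Param p) (i j : Fin p) :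
    coeffMat ν i j = if i = j then ν (i, j) else -ν (i, j) := by
  by_cases h : i = j
  · subst h; simp [coeffMat, rho, adj]
  · simp [coeffMat, adj, h]

theorem coeffMat_sub {p : ℕ} (μ ν : Param p) : coeffMat (μ - ν) = coeffMat μ - coeffMat ν := by
  ext i j
  by_cases h : i = j
  · simp [coeffMat_apply, h]
  · simp [coeffMat_apply, h]; ring

theorem abs_coord_le_norm {p : ℕ} (ν : Param p) (e : Fin p × Fin p) : |ν e| ≤ ‖ν‖ := by
  simpa using PiLp.norm_apply_le ν e

theorem abs_coeffMat_le {p : ℕ} (ν : Param p) (i j : Fin p) : |coeffMat ν i j| ≤ ‖ν‖ := by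
  have h := abs_coord_le_norm ν (i, j)
  rw [coeffMat_apply]
  split_ifs <;> simpa using h

/-- The normalized Gaussian log-likelihood `∑_j log ρ_j - tr((R - Φ)ᵀ S (R - Φ)) / 2` of a
second-moment matrix `S`. -/
noncomputable def gaussObj {p : ℕ} (S : Matrix (Fin p) (Fin p) ℝ) (ν : Param p) : ℝ :=
  ∑ j, Real.log (rho ν j) - (1 / 2) * ((coeffMat ν).transpose * S * coeffMat ν).trace

theorem isSymm_sampleCov {p n : ℕ} (x : Matrix (Fin n) (Fin p) ℝ) : (sampleCov x).IsSymm := by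
  simp [Matrix.IsSymm, sampleCov, Matrix.transpose_smul, Matrix.transpose_mul]

theorem logLik_eq_mul_gaussObj {p n : ℕ} (hn : 0 < n) (x : Matrix (Fin n) (Fin p) ℝ)
    (ν : Param p) : logLik n x ν = n * gaussObj (sampleCov x) ν := by
  have hn' : (n : ℝ) ≠ 0 := Nat.cast_ne_zero.2 hn.ne'
  have h1 : ∀ j k, rho ν j * x k j - (x * adj ν) k j = (x * coeffMat ν) k j := by
    intro j k
    simp [coeffMat, Matrix.mul_sub, Matrix.mul_diagonal, mul_comm]
  have h2 : (n : ℝ) * ((coeffMat ν).transpose * sampleCov x * coeffMat ν).trace =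
      ∑ j, ∑ k, (x * coeffMat ν) k j ^ 2 := by
    have : (coeffMat ν).transpose * sampleCov x * coeffMat ν =
        (n : ℝ)⁻¹ • ((x * coeffMat ν).transpose * (x * coeffMat ν)) := by
      simp [sampleCov, Matrix.transpose_mul, Matrix.mul_assoc]
    rw [this, Matrix.trace_smul, smul_eq_mul, mul_inv_cancel_left₀ hn']
    simp only [Matrix.trace, Matrix.diag_apply, Matrix.mul_apply, Matrix.transpose_apply, sq]
  unfold logLik gaussObj
  simp only [h1]
  rw [Finset.sum_sub_distrib, ← Finset.mul_sum, ← Finset.mul_sum, ← h2]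
  ring

theorem penLogLik_eq {p n : ℕ} (hn : 0 < n) (pen : ℝ → ℝ) (x : Matrix (Fin n) (Fin p) ℝ)
    (ν : Param p) :
    penLogLik pen n x ν = n * (gaussObj (sampleCov x) ν - penalty pen ν) := by
  rw [penLogLik, logLik_eq_mul_gaussObj hn]; ring

theorem trace_mul_mul_eq_add {p : ℕ} (S Sigma₀ A C : Matrix (Fin p) (Fin p) ℝ) :
    (A.transpose * S * C).trace =
      (A.transpose * Sigma₀ * C).trace + (A.transpose * (S - Sigma₀) * C).trace := by
  rw [← Matrix.trace_add, ← Matrix.add_mul, ← Matrix.mul_add, add_sub_cancel]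

/-- A crude entrywise bound for the bilinear form `(μ, ν) ↦ tr(B_μᵀ E B_ν)`, where `B_μ` and `B_ν`
are the coefficient matrices. -/
theorem abs_trace_le {p : ℕ} {E : Matrix (Fin p) (Fin p) ℝ} {ζ : ℝ}
    (hE : ∀ i j, |E i j| ≤ ζ) (μ ν : Param p) :
    |((coeffMat μ).transpose * E * coeffMat ν).trace| ≤ (p : ℝ) ^ 3 * ζ * ‖μ‖ * ‖ν‖ := by
  have h1 : ((coeffMat μ).transpose * E * coeffMat ν).trace =
      ∑ j, ∑ k, ∑ i, coeffMat μ i j * E i k * coeffMat ν k j := by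
    simp [Matrix.trace, Matrix.mul_apply, Finset.sum_mul]
  rw [h1]
  have h2 : ∀ i j k, |coeffMat μ i j * E i k * coeffMat ν k j| ≤ ‖μ‖ * ζ * ‖ν‖ := by
    intro i j k
    rw [abs_mul, abs_mul]
    have hζ : 0 ≤ ζ := (abs_nonneg _).trans (hE i k)
    exact mul_le_mul (mul_le_mul (abs_coeffMat_le μ i j) (hE i k) (abs_nonneg _) (norm_nonneg _))
      (abs_coeffMat_le ν k j) (abs_nonneg _) (mul_nonneg (norm_nonneg _) hζ)
  calc |∑ j, ∑ k, ∑ i, coeffMat μ i j * E i k * coeffMat ν k j|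
      ≤ ∑ j : Fin p, ∑ k : Fin p, ∑ i : Fin p, ‖μ‖ * ζ * ‖ν‖ := by
        refine (Finset.abs_sum_le_sum_abs _ _).trans (Finset.sum_le_sum fun j _ => ?_)
        refine (Finset.abs_sum_le_sum_abs _ _).trans (Finset.sum_le_sum fun k _ => ?_)
        exact (Finset.abs_sum_le_sum_abs _ _).trans (Finset.sum_le_sum fun i _ => h2 i j k)
    _ = (p : ℝ) ^ 3 * ζ * ‖μ‖ * ‖ν‖ := by simp; ring

theorem continuous_coeffMat {p : ℕ} : Continuous (coeffMat : Param p → _) := by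
  refine continuous_matrix fun i j => ?_
  simp only [coeffMat_apply]
  split_ifs <;> fun_prop

/-- The quadratic part of the likelihood is uniformly positive, by homogeneity and compactness of
the unit sphere. -/
theorem exists_pos_mul_sq_le_trace {p : ℕ} {Sigma₀ : Matrix (Fin p) (Fin p) ℝ}
    (hSigma : Sigma₀.PosDef) :
    ∃ κ : ℝ, 0 < κ ∧ ∀ ν : Param p,
      κ * ‖ν‖ ^ 2 ≤ ((coeffMat ν).transpose * Sigma₀ * coeffMat ν).trace := by
  have hcol : ∀ ν : Param p, ((coeffMat ν).transpose * Sigma₀ * coeffMat ν).trace =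
      ∑ j, (coeffMat ν).transpose j ⬝ᵥ Sigma₀.mulVec ((coeffMat ν).transpose j) := by
    intro ν
    simp only [Matrix.mul_assoc]
    simp [Matrix.trace, Matrix.mul_apply, dotProduct, Matrix.mulVec]
  have hpos : ∀ ν : Param p, ν ≠ 0 →
      0 < ((coeffMat ν).transpose * Sigma₀ * coeffMat ν).trace := by
    intro ν hν
    rw [hcol]
    obtain ⟨⟨i, j⟩, hij⟩ : ∃ e, ν e ≠ 0 := by
      by_contra! h
      exact hν (by ext e; exact h e)
    refine Finset.sum_pos' (fun k _ => ?_) ⟨j, Finset.mem_univ _, ?_⟩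
    · simpa using hSigma.posSemidef.dotProduct_mulVec_nonneg ((coeffMat ν).transpose k)
    · refine lt_of_lt_of_eq (hSigma.dotProduct_mulVec_pos (x := (coeffMat ν).transpose j)
        fun h => hij ?_) (by simp)
      have := congrFun h i
      rw [Matrix.transpose_apply, coeffMat_apply] at this
      split_ifs at this <;> simpa using this
  have hcont : Continuous fun ν : Param p =>
      ((coeffMat ν).transpose * Sigma₀ * coeffMat ν).trace := by
    have := continuous_coeffMat (p := p)
    fun_prop
  have hsmul : ∀ (c : ℝ) (ν : Param p), coeffMat (c • ν) = c • coeffMat ν := by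
    intro c ν
    ext i j
    simp [coeffMat_apply]
  have h0 : coeffMat (0 : Param p) = 0 := by simpa using hsmul 0 (0 : Param p)
  rcases (Metric.sphere (0 : Param p) 1).eq_empty_or_nonempty with hemp | hne
  · refine ⟨1, one_pos, fun ν => ?_⟩
    have hν : ν = 0 := by
      by_contra hν
      have : ‖ν‖⁻¹ • ν ∈ Metric.sphere (0 : Param p) 1 := by
        simp [norm_smul, hν]
      rw [hemp] at this
      exact this
    simp [hν, h0]
  · obtain ⟨m, hm, hmin⟩ := (isCompact_sphere (0 : Param p) 1).exists_isMinOn hne hcont.continuousOn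
    refine ⟨_, hpos m (Metric.ne_of_mem_sphere hm one_ne_zero), fun ν => ?_⟩
    by_cases hν : ν = 0
    · simp [hν, h0]
    have hν' : ‖ν‖ ≠ 0 := norm_ne_zero_iff.2 hν
    have h := hmin (show ‖ν‖⁻¹ • ν ∈ Metric.sphere (0 : Param p) 1 by simp [norm_smul, hν])
    simp only [Set.mem_ofPred_eq, hsmul, Matrix.transpose_smul, Matrix.smul_mul, Matrix.mul_smul,
      Matrix.trace_smul, smul_eq_mul] at h
    rw [← mul_assoc, ← sq, inv_pow, ← div_eq_inv_mul, le_div_iff₀ (by positivity)] at h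
    exact h

/-- The ancestor count is a topological order: on a DAG it strictly increases along edges. -/
theorem GaussianDAG.IsDAG.exists_rank {p : ℕ} {A : Matrix (Fin p) (Fin p) ℝ} (hA : IsDAG A) :
    ∃ b : Fin p → ℕ, ∀ i j, A i j ≠ 0 → b i < b j := by
  classical
  refine ⟨fun i => (Finset.univ.filter
    fun k => Relation.TransGen (fun k l => A k l ≠ 0) k i).card, fun i j hij => ?_⟩
  refine Finset.card_lt_card ⟨fun k hk => ?_, fun h => ?_⟩
  · simp only [Finset.mem_filter, Finset.mem_univ, true_and] at hk ⊢
    exact hk.tail hij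
  · have hi : i ∈ Finset.univ.filter fun k => Relation.TransGen (fun k l => A k l ≠ 0) k j :=
      Finset.mem_filter.2 ⟨Finset.mem_univ _, Relation.TransGen.single hij⟩
    exact hA i (Finset.mem_filter.1 (h hi)).2

/-- The score identity behind consistency: for a DAG `ν` which contains all edges of `ν₀`, the
matrices `(R₀ - Φ₀)⁻¹ = (R₀ - Φ₀)ᵀ Σ₀` and `R - Φ` are triangular in a common order, so that the
diagonal of their product is `ρ_j / ρ_j⁰`. -/
theorem trace_transpose_mul_mul_eq_sum_div {p : ℕ} {Sigma₀ : Matrix (Fin p) (Fin p) ℝ}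
    (hSigma : Sigma₀.PosDef) {ν₀ ν : Param p} (hν₀ : ν₀ ∈ equivClass Sigma₀⁻¹)
    (hν : ν ∈ dagSpace p) (hsupp : ∀ i j, adj ν₀ i j ≠ 0 → adj ν i j ≠ 0) :
    ((coeffMat ν₀).transpose * Sigma₀ * coeffMat ν).trace = ∑ j, rho ν j / rho ν₀ j := by
  obtain ⟨b, hb⟩ := hν.1.exists_rank
  have hinv : coeffMat ν₀ * ((coeffMat ν₀).transpose * Sigma₀) = 1 := by
    rw [← Matrix.mul_assoc]
    have h : coeffMat ν₀ * (coeffMat ν₀).transpose = Sigma₀⁻¹ := hν₀.2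
    rw [h]
    exact Matrix.nonsing_inv_mul _ hSigma.det_pos.ne'.isUnit
  have hinv' : (coeffMat ν₀).transpose * Sigma₀ * coeffMat ν₀ = 1 :=
    mul_eq_one_comm.1 hinv
  have hzero : ∀ μ : Param p, (∀ i j, adj μ i j ≠ 0 → adj ν i j ≠ 0) →
      ∀ i j, i ≠ j → coeffMat μ i j ≠ 0 → b i < b j := by
    intro μ hμ i j hij h
    refine hb i j (hμ i j ?_)
    simpa [coeffMat_apply, hij, adj] using h
  set C := (coeffMat ν₀).transpose * Sigma₀ with hC
  have hCtri : ∀ j k, C j k ≠ 0 → b j ≤ b k := by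
    have htri : (coeffMat ν₀).BlockTriangular b := by
      intro i j hij
      by_contra h
      have hne : i ≠ j := by rintro rfl; exact lt_irrefl _ hij
      exact lt_asymm hij (hzero ν₀ hsupp i j hne h)
    let _ : Invertible (coeffMat ν₀) := ⟨C, hinv', hinv⟩
    have h := Matrix.blockTriangular_inv_of_blockTriangular htri
    rw [Matrix.inv_eq_left_inv hinv'] at h
    intro j k hjk
    by_contra hlt
    exact hjk (h (not_le.1 hlt))
  have hdiag : ∀ μ : Param p, (∀ i j, adj μ i j ≠ 0 → adj ν i j ≠ 0) →
      ∀ j, (C * coeffMat μ) j j = C j j * rho μ j := by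
    intro μ hμ j
    rw [Matrix.mul_apply, Finset.sum_eq_single j]
    · simp [coeffMat_apply, rho]
    · intro k _ hkj
      by_contra h
      have h1 := hCtri j k (left_ne_zero_of_mul h)
      have h2 := hzero μ hμ k j hkj (right_ne_zero_of_mul h)
      omega
    · simp
  refine Finset.sum_congr rfl fun j _ => ?_
  rw [Matrix.diag_apply, hdiag ν (fun _ _ h => h)]
  have h1 := hdiag ν₀ hsupp j
  rw [hinv', Matrix.one_apply_eq] at h1
  rw [eq_div_iff (hν₀.1.2 j).ne']
  linear_combination (-rho ν j) * h1

/-- Near-concavity bound for the likelihood ratio: a linear term governed by the sampling error of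
`S` and a negative quadratic term. The logarithms lie below their tangents, the rest is exactly
quadratic, and the linear terms at `Σ₀` cancel by the score identity. -/
theorem gaussObj_sub_le {p : ℕ} {Sigma₀ : Matrix (Fin p) (Fin p) ℝ}
    (hSigma : Sigma₀.PosDef) {ν₀ ν : Param p} (hν₀ : ν₀ ∈ equivClass Sigma₀⁻¹)
    (hν : ν ∈ dagSpace p) (hsupp : ∀ i j, adj ν₀ i j ≠ 0 → adj ν i j ≠ 0) {κ : ℝ}
    (hκ : ∀ ν : Param p, κ * ‖ν‖ ^ 2 ≤ ((coeffMat ν).transpose * Sigma₀ * coeffMat ν).trace)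
    {S : Matrix (Fin p) (Fin p) ℝ} (hS : S.IsSymm) {ζ : ℝ}
    (hζ : ∀ i j, |S i j - Sigma₀ i j| ≤ ζ) :
    gaussObj S ν - gaussObj S ν₀ ≤ (p : ℝ) ^ 3 * ζ * ‖ν₀‖ * ‖ν - ν₀‖ -
      (1 / 2) * (κ - (p : ℝ) ^ 3 * ζ) * ‖ν - ν₀‖ ^ 2 := by
  have hE : ∀ i j, |(S - Sigma₀) i j| ≤ ζ := hζ
  set H := coeffMat (ν - ν₀) with hH
  have hB : coeffMat ν = coeffMat ν₀ + H := by rw [hH, coeffMat_sub]; abel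
  set B₀ := coeffMat ν₀ with hB₀
  have hlog : ∑ j, Real.log (rho ν j) - ∑ j, Real.log (rho ν₀ j) ≤
      ∑ j, (rho ν j / rho ν₀ j - rho ν₀ j / rho ν₀ j) := by
    rw [← Finset.sum_sub_distrib]
    refine Finset.sum_le_sum fun j _ => ?_
    have h1 := hν.2 j
    have h2 := hν₀.1.2 j
    rw [← Real.log_div h1.ne' h2.ne', div_self h2.ne']
    exact Real.log_le_sub_one_of_pos (div_pos h1 h2)
  have hscore : (B₀.transpose * Sigma₀ * H).trace =
      ∑ j, (rho ν j / rho ν₀ j - rho ν₀ j / rho ν₀ j) := by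
    rw [hH, coeffMat_sub, Matrix.mul_sub, Matrix.trace_sub,
      trace_transpose_mul_mul_eq_sum_div hSigma hν₀ hν hsupp,
      trace_transpose_mul_mul_eq_sum_div hSigma hν₀ hν₀.1 fun _ _ h => h, Finset.sum_sub_distrib]
  have hsplit := trace_mul_mul_eq_add S Sigma₀
  have hsymm : (H.transpose * S * B₀).trace = (B₀.transpose * S * H).trace := by
    rw [← Matrix.trace_transpose]
    simp [Matrix.transpose_mul, hS.eq, Matrix.mul_assoc]
  have hexp : ((coeffMat ν).transpose * S * coeffMat ν).trace =
      (B₀.transpose * S * B₀).trace + 2 * (B₀.transpose * S * H).trace +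
        (H.transpose * S * H).trace := by
    rw [hB]
    simp only [Matrix.transpose_add, Matrix.add_mul, Matrix.mul_add, Matrix.trace_add, hsymm]
    ring
  have e1 := (abs_le.1 (abs_trace_le hE ν₀ (ν - ν₀))).1
  have e2 := (abs_le.1 (abs_trace_le hE (ν - ν₀) (ν - ν₀))).1
  have e3 := hκ (ν - ν₀)
  have e4 := hsplit B₀ H
  have e5 := hsplit H H
  simp only [gaussObj, hexp]
  simp only [← hH, ← hB₀] at e1 e2 e3
  nlinarith [hlog, hscore]

/-! ### The penalty near the true coefficients -/

theorem continuous_adj_apply {p : ℕ} (i j : Fin p) : Continuous fun ν : Param p => adj ν i j := by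
  simp only [adj, Matrix.of_apply]
  split_ifs <;> fun_prop

theorem abs_abs_adj_sub_le {p : ℕ} (ν ν₀ : Param p) (i j : Fin p) :
    |(|adj ν i j| - |adj ν₀ i j|)| ≤ ‖ν - ν₀‖ := by
  refine (abs_abs_sub_abs_le _ _).trans ?_
  by_cases h : i = j
  · simp [adj, h]
  · simpa [adj, h] using abs_coord_le_norm (ν - ν₀) (i, j)

theorem penalty_eq {p : ℕ} (pen : ℝ → ℝ) (ν : Param p) :
    penalty pen ν = ∑ i, ∑ j, if i = j then 0 else pen |adj ν i j| := by
  refine Finset.sum_congr rfl fun i _ => Finset.sum_congr rfl fun j _ => ?_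
  by_cases h : i = j <;> simp [h, adj]

theorem maxSlope_nonneg {p : ℕ} (pen : ℝ → ℝ) (ν : Param p) : 0 ≤ maxSlope pen ν :=
  Real.iSup_nonneg fun _ => abs_nonneg _

/-- Second-order expansion, uniform in the index, of penalties with asymptotically equicontinuous
second derivatives. -/
theorem GaussianDAG.EquiC2At.eventually_sub_le {q : ℕ → ℝ → ℝ} {t₀ : ℝ} (h : EquiC2At q t₀) {η : ℝ}
    (hη : 0 < η) :
    ∀ᶠ z : ℕ × ℝ in atTop ×ˢ 𝓝 t₀, q z.1 t₀ - q z.1 z.2 ≤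
      |deriv (q z.1) t₀| * |z.2 - t₀| +
        (|deriv (deriv (q z.1)) t₀| + η) * |z.2 - t₀| ^ 2 := by
  have h2 := h.2.eventually (Metric.ball_mem_nhds (0 : ℝ) hη)
  obtain ⟨⟨N, δ⟩, ⟨-, hδ⟩, hball⟩ :=
    (atTop_basis.prod Metric.nhds_basis_ball).eventually_iff.1 (h.1.and h2)
  refine (atTop_basis.prod Metric.nhds_basis_ball).eventually_iff.2
    ⟨⟨N, δ⟩, ⟨trivial, hδ⟩, ?_⟩
  rintro ⟨n, t⟩ ⟨hn, ht⟩
  have hn : N ≤ n := hn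
  have ht : dist t t₀ < δ := ht
  set c := |deriv (deriv (q n)) t₀| + η with hc
  set s := Metric.closedBall t₀ |t - t₀| with hs
  have hmem : ∀ u ∈ s, DifferentiableAt ℝ (q n) u ∧ DifferentiableAt ℝ (deriv (q n)) u ∧
      ‖deriv (deriv (q n)) u‖ ≤ c := by
    intro u hu
    have hu' : dist u t₀ ≤ |t - t₀| := hu
    rw [← Real.dist_eq] at hu'
    obtain ⟨⟨h3, h4⟩, h5⟩ := hball (show ((n, u) : ℕ × ℝ) ∈ Set.Ici N ×ˢ Metric.ball t₀ δ from
      ⟨hn, hu'.trans_lt ht⟩)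
    refine ⟨h3, h4, ?_⟩
    have h5 : |deriv (deriv (q n)) u - deriv (deriv (q n)) t₀| < η := by simpa using h5
    have := abs_sub_abs_le_abs_sub (deriv (deriv (q n)) u) (deriv (deriv (q n)) t₀)
    rw [Real.norm_eq_abs, hc]
    linarith
  have hconv : Convex ℝ s := convex_closedBall _ _
  have ht₀s : t₀ ∈ s := Metric.mem_closedBall_self (abs_nonneg _)
  have hts : t ∈ s := by simp [hs, Real.dist_eq]
  have hc0 : 0 ≤ c := add_nonneg (abs_nonneg _) hη.le
  have hderiv : ∀ u ∈ s, ‖deriv (q n) u - deriv (q n) t₀‖ ≤ c * |t - t₀| := by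
    intro u hu
    refine (hconv.norm_image_sub_le_of_norm_deriv_le (fun v hv => (hmem v hv).2.1)
      (fun v hv => (hmem v hv).2.2) ht₀s hu).trans ?_
    exact mul_le_mul_of_nonneg_left hu hc0
  have hf : ∀ u ∈ s, HasDerivAt (fun u => q n u - deriv (q n) t₀ * u)
      (deriv (q n) u - deriv (q n) t₀) u := fun u hu => by
    simpa using! (hmem u hu).1.hasDerivAt.sub ((hasDerivAt_id u).const_mul (deriv (q n) t₀))
  have hmain := hconv.norm_image_sub_le_of_norm_hasDerivWithin_le
    (fun u hu => (hf u hu).hasDerivWithinAt) hderiv ht₀s hts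
  rw [Real.norm_eq_abs, Real.norm_eq_abs] at hmain
  have h6 := (abs_le.1 hmain).1
  have h7 := neg_abs_le (deriv (q n) t₀ * (t - t₀))
  rw [abs_mul] at h7
  change q n t₀ - q n t ≤ |deriv (q n) t₀| * |t - t₀| + c * |t - t₀| ^ 2
  nlinarith

/-- The penalty decreases, locally around `ν₀`, at most by a linear term of size `maxSlope` and a
small quadratic term: coefficients that vanish in `ν₀` can only increase it. -/
theorem eventually_penalty_sub_le {p : ℕ} {q : ℕ → ℝ → ℝ}
    (hmono : ∀ n, MonotoneOn (q n) (Set.Ici 0)) (ν₀ : Param p)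
    (hreg : ∀ i j, adj ν₀ i j ≠ 0 → EquiC2At q |adj ν₀ i j|)
    (hb : Tendsto (fun n => maxCurvature (q n) ν₀) atTop (𝓝 0)) {η : ℝ} (hη : 0 < η) :
    ∀ᶠ z : ℕ × Param p in atTop ×ˢ 𝓝 ν₀, penalty (q z.1) ν₀ - penalty (q z.1) z.2 ≤
      (p : ℝ) ^ 2 * (maxSlope (q z.1) ν₀ * ‖z.2 - ν₀‖ + η * ‖z.2 - ν₀‖ ^ 2) := by
  have h1 : ∀ᶠ z : ℕ × Param p in atTop ×ˢ 𝓝 ν₀, maxCurvature (q z.1) ν₀ < η / 2 :=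
    (hb.eventually (gt_mem_nhds (half_pos hη))).prod_inl _
  have h2 : ∀ᶠ z : ℕ × Param p in atTop ×ˢ 𝓝 ν₀, ∀ i j, adj ν₀ i j ≠ 0 →
      q z.1 |adj ν₀ i j| - q z.1 |adj z.2 i j| ≤
        abs (deriv (q z.1) |adj ν₀ i j|) * |(|adj z.2 i j| - |adj ν₀ i j|)| +
        (abs (deriv (deriv (q z.1)) |adj ν₀ i j|) + η / 2) *
          |(|adj z.2 i j| - |adj ν₀ i j|)| ^ 2 := by
    refine eventually_all.2 fun i => eventually_all.2 fun j => ?_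
    by_cases hij : adj ν₀ i j = 0
    · exact Eventually.of_forall fun z h => absurd hij h
    · have ht : Tendsto (fun z : ℕ × Param p => (z.1, |adj z.2 i j|)) (atTop ×ˢ 𝓝 ν₀)
          (atTop ×ˢ 𝓝 |adj ν₀ i j|) :=
        tendsto_fst.prodMk
          (((continuous_adj_apply i j).abs.tendsto ν₀).comp tendsto_snd)
      filter_upwards [ht.eventually ((hreg i j hij).eventually_sub_le (half_pos hη))] with z hz _
      exact hz
  filter_upwards [h1, h2] with z hz1 hz2
  obtain ⟨n, ν⟩ := z
  simp only at hz1 hz2 ⊢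
  have ha := maxSlope_nonneg (q n) ν₀
  have hterm : ∀ i j, ((if i = j then 0 else q n |adj ν₀ i j|) -
      if i = j then 0 else q n |adj ν i j|) ≤
        maxSlope (q n) ν₀ * ‖ν - ν₀‖ + η * ‖ν - ν₀‖ ^ 2 := by
    intro i j
    have hpos : 0 ≤ maxSlope (q n) ν₀ * ‖ν - ν₀‖ + η * ‖ν - ν₀‖ ^ 2 := by positivity
    by_cases hij : i = j
    · simpa [hij] using hpos
    rw [if_neg hij, if_neg hij]
    by_cases h0 : adj ν₀ i j = 0
    · have := hmono n (Set.mem_Ici.2 le_rfl) (Set.mem_Ici.2 (abs_nonneg (adj ν i j)))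
        (abs_nonneg (adj ν i j))
      rw [h0, abs_zero]
      linarith
    · have hs : abs (deriv (q n) |adj ν₀ i j|) ≤ maxSlope (q n) ν₀ :=
        le_ciSup (f := fun e : Edge ν₀ => abs (deriv (q n) |adj ν₀ e.1.1 e.1.2|))
          (Set.finite_range _).bddAbove ⟨(i, j), h0⟩
      have hk : abs (deriv (deriv (q n)) |adj ν₀ i j|) ≤ maxCurvature (q n) ν₀ :=
        le_ciSup (f := fun e : Edge ν₀ => abs (deriv (deriv (q n)) |adj ν₀ e.1.1 e.1.2|))
          (Set.finite_range _).bddAbove ⟨(i, j), h0⟩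
      have hd := abs_abs_adj_sub_le ν ν₀ i j
      refine (hz2 i j h0).trans (add_le_add ?_ ?_)
      · exact mul_le_mul hs hd (abs_nonneg _) ha
      · exact mul_le_mul (by linarith) (pow_le_pow_left₀ (abs_nonneg _) hd 2) (by positivity) hη.le
  rw [penalty_eq, penalty_eq, ← Finset.sum_sub_distrib]
  calc ∑ i, ((∑ j, if i = j then 0 else q n |adj ν₀ i j|) -
        ∑ j, if i = j then 0 else q n |adj ν i j|)
      ≤ ∑ i : Fin p, ∑ j : Fin p, (maxSlope (q n) ν₀ * ‖ν - ν₀‖ + η * ‖ν - ν₀‖ ^ 2) := by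
        refine Finset.sum_le_sum fun i _ => ?_
        rw [← Finset.sum_sub_distrib]
        exact Finset.sum_le_sum fun j _ => hterm i j
    _ = _ := by simp; ring

/-! ### Compact pieces of the DAG space -/

theorem eventually_adj_ne_zero {p : ℕ} (ν₀ : Param p) :
    ∀ᶠ ν in 𝓝 ν₀, ∀ i j, adj ν₀ i j ≠ 0 → adj ν i j ≠ 0 := by
  refine eventually_all.2 fun i => eventually_all.2 fun j => ?_
  by_cases h : adj ν₀ i j = 0
  · exact Eventually.of_forall fun _ h' => absurd h h'
  · filter_upwards [(continuous_adj_apply i j).continuousAt.eventually_ne h] with ν hν _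
    exact hν

/-- Acyclicity is a closed condition: edges persist under small perturbations, hence so do
cycles. -/
theorem isClosed_setOf_isDAG (p : ℕ) : IsClosed {ν : Param p | IsDAG (adj ν)} := by
  rw [← isOpen_compl_iff, isOpen_iff_eventually]
  intro ν hν
  simp only [IsDAG, Set.mem_compl_iff, Set.mem_ofPred_eq, not_forall, not_not] at hν ⊢
  obtain ⟨i, hi⟩ := hν
  filter_upwards [eventually_adj_ne_zero ν] with μ hμ
  exact ⟨i, Relation.TransGen.mono (fun k l hkl => hμ k l hkl) _ _ hi⟩

/-- The part of the DAG space with all `ρ_j ≥ r` and at distance at most `R` from `c`. For `r > 0`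
it is compact. -/
def dagBox {p : ℕ} (c : Param p) (r R : ℝ) : Set (Param p) :=
  {ν | IsDAG (adj ν) ∧ (∀ j, r ≤ rho ν j) ∧ ‖ν - c‖ ≤ R}

theorem dagBox_subset_dagSpace {p : ℕ} {c : Param p} {r R : ℝ} (hr : 0 < r) :
    dagBox c r R ⊆ dagSpace p := fun _ hν => ⟨hν.1, fun j => hr.trans_le (hν.2.1 j)⟩

theorem continuous_rho {p : ℕ} (j : Fin p) : Continuous fun ν : Param p => rho ν j := by
  unfold rho; fun_prop

theorem isCompact_dagBox {p : ℕ} (c : Param p) (r R : ℝ) : IsCompact (dagBox c r R) := by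
  have : dagBox c r R = Metric.closedBall c R ∩
      ({ν | IsDAG (adj ν)} ∩ ⋂ j, {ν : Param p | r ≤ rho ν j}) := by
    ext ν
    simp [dagBox, dist_eq_norm]
    tauto
  rw [this]
  exact (isCompact_closedBall c R).inter_right ((isClosed_setOf_isDAG p).inter
    (isClosed_iInter fun j => isClosed_le continuous_const (continuous_rho j)))

theorem continuous_logLik_data {p : ℕ} (n : ℕ) (ν : Param p) :
    Continuous fun y : Fin n → Fin p → ℝ => logLik n (Matrix.of y) ν := by
  simp only [logLik, Matrix.mul_apply, Matrix.of_apply]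
  fun_prop

theorem upperSemicontinuousOn_penLogLik {p : ℕ} {pen : ℝ → ℝ}
    (hlsc : LowerSemicontinuousOn pen (Set.Ici 0)) (n : ℕ) (x : Matrix (Fin n) (Fin p) ℝ) :
    UpperSemicontinuousOn (penLogLik pen n x) (dagSpace p) := by
  have h1 : ContinuousOn (logLik n x) (dagSpace p) := by
    unfold logLik
    refine continuousOn_finsetSum _ fun j _ => ?_
    have hr := continuous_rho (p := p) j
    have hA := fun i => continuous_adj_apply (p := p) i j
    refine ContinuousOn.sub (continuousOn_const.mul
      (hr.continuousOn.log fun ν hν => (hν.2 j).ne')) (Continuous.continuousOn ?_)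
    simp only [Matrix.mul_apply]
    fun_prop
  have h2 : LowerSemicontinuous (penalty pen : Param p → ℝ) := by
    have : (penalty pen : Param p → ℝ) =
        fun ν => ∑ i, ∑ j, if i = j then 0 else pen |ν (i, j)| := rfl
    rw [this]
    refine lowerSemicontinuous_sum fun i _ => lowerSemicontinuous_sum fun j _ => ?_
    by_cases hij : i = j
    · simpa [hij] using lowerSemicontinuous_const
    · simp only [hij, if_false]
      rw [← lowerSemicontinuousOn_univ_iff]
      exact hlsc.comp (g := fun ν : Param p => |ν (i, j)|)
        (Continuous.continuousOn (by fun_prop)) fun ν _ => Set.mem_Ici.2 (abs_nonneg _)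
  have h3 : UpperSemicontinuous fun ν : Param p => -((n : ℝ) * penalty pen ν) :=
    Continuous.comp_lowerSemicontinuous_antitone (g := fun y : ℝ => -((n : ℝ) * y))
      (by fun_prop) h2
      fun a b hab => neg_le_neg (mul_le_mul_of_nonneg_left hab (Nat.cast_nonneg n))
  have h4 : penLogLik pen n x = fun ν => logLik n x ν + -((n : ℝ) * penalty pen ν) := by
    ext ν; rw [penLogLik, sub_eq_add_neg]
  rw [h4]
  exact h1.upperSemicontinuousOn.add (h3.upperSemicontinuousOn _)

/-! ### Localization of the maximizers -/

/-- If `S` is within `ζ` of `Σ₀`, then no DAG near `ν₀` but farther than a multiple of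
`ζ + maxSlope` from it does as well as `ν₀`. The neighbourhood does not shrink with `n`. -/
theorem exists_norm_sub_le_of_le {p : ℕ} {Sigma₀ : Matrix (Fin p) (Fin p) ℝ}
    (hSigma : Sigma₀.PosDef) {q : ℕ → ℝ → ℝ} (hmono : ∀ n, MonotoneOn (q n) (Set.Ici 0))
    {ν₀ : Param p} (hν₀ : ν₀ ∈ equivClass Sigma₀⁻¹)
    (hreg : ∀ i j, adj ν₀ i j ≠ 0 → EquiC2At q |adj ν₀ i j|)
    (hb : Tendsto (fun n => maxCurvature (q n) ν₀) atTop (𝓝 0)) :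
    ∃ M > 0, ∃ ζ₀ > 0, ∃ r₀ > 0, ∀ᶠ n in atTop, ∀ S : Matrix (Fin p) (Fin p) ℝ, S.IsSymm →
      ∀ ζ, 0 ≤ ζ → ζ ≤ ζ₀ → (∀ i j, |S i j - Sigma₀ i j| ≤ ζ) →
      ∀ ν ∈ dagSpace p, ‖ν - ν₀‖ ≤ r₀ →
      gaussObj S ν₀ - penalty (q n) ν₀ ≤ gaussObj S ν - penalty (q n) ν →
      ‖ν - ν₀‖ ≤ M * (ζ + maxSlope (q n) ν₀) := by
  obtain ⟨κ, hκ0, hκ⟩ := exists_pos_mul_sq_le_trace hSigma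
  have hη : 0 < κ / (8 * ((p : ℝ) ^ 2 + 1)) := by positivity
  have hev := (eventually_penalty_sub_le hmono ν₀ hreg hb hη).and
    ((eventually_adj_ne_zero ν₀).prod_inr atTop)
  obtain ⟨⟨N, r₀⟩, ⟨-, hr₀⟩, hball⟩ :=
    (atTop_basis.prod Metric.nhds_basis_closedBall).eventually_iff.1 hev
  refine ⟨8 * ((p : ℝ) ^ 3 * ‖ν₀‖ + (p : ℝ) ^ 2) / κ + 1, by positivity,
    κ / (2 * ((p : ℝ) ^ 3 + 1)), by positivity, r₀, hr₀, ?_⟩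
  filter_upwards [eventually_ge_atTop N] with n hn S hS ζ hζ0 hζ hSζ ν hν hνr hle
  obtain ⟨hpen, hsupp⟩ := hball (show ((n, ν) : ℕ × Param p) ∈
    Set.Ici N ×ˢ Metric.closedBall ν₀ r₀ from ⟨hn, by rwa [mem_closedBall_iff_norm]⟩)
  simp only at hpen hsupp
  have hg := gaussObj_sub_le hSigma hν₀ hν hsupp hκ hS hSζ
  set d := ‖ν - ν₀‖ with hd
  have hd0 : 0 ≤ d := norm_nonneg _
  set a := maxSlope (q n) ν₀ with ha
  have ha0 : 0 ≤ a := maxSlope_nonneg _ _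
  have h1 : (p : ℝ) ^ 3 * ζ ≤ κ / 2 := by
    calc (p : ℝ) ^ 3 * ζ ≤ ((p : ℝ) ^ 3 + 1) * (κ / (2 * ((p : ℝ) ^ 3 + 1))) :=
          mul_le_mul (by linarith) hζ hζ0 (by positivity)
      _ = κ / 2 := by field_simp
  have h2 : (p : ℝ) ^ 2 * (κ / (8 * ((p : ℝ) ^ 2 + 1))) ≤ κ / 8 := by
    rw [mul_div_assoc', div_le_div_iff₀ (by positivity) (by positivity)]
    nlinarith
  have h3 : κ / 8 * d ^ 2 ≤ ((p : ℝ) ^ 3 * ‖ν₀‖ * ζ + (p : ℝ) ^ 2 * a) * d := by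
    have h4 := mul_le_mul_of_nonneg_right h1 (sq_nonneg d)
    have h5 := mul_le_mul_of_nonneg_right h2 (sq_nonneg d)
    nlinarith
  rcases hd0.eq_or_lt with h0 | hdpos
  · rw [← h0]
    positivity
  have h4 : κ / 8 * d ≤ (p : ℝ) ^ 3 * ‖ν₀‖ * ζ + (p : ℝ) ^ 2 * a := by
    rw [sq, ← mul_assoc] at h3
    exact le_of_mul_le_mul_right h3 hdpos
  have h5 : (p : ℝ) ^ 3 * ‖ν₀‖ * ζ + (p : ℝ) ^ 2 * a ≤
      ((p : ℝ) ^ 3 * ‖ν₀‖ + (p : ℝ) ^ 2) * (ζ + a) := by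
    have h6 : 0 ≤ (p : ℝ) ^ 3 * ‖ν₀‖ * a := by positivity
    have h7 : 0 ≤ (p : ℝ) ^ 2 * ζ := by positivity
    linarith
  calc d = 8 / κ * (κ / 8 * d) := by field_simp
    _ ≤ 8 / κ * (((p : ℝ) ^ 3 * ‖ν₀‖ + (p : ℝ) ^ 2) * (ζ + a)) :=
        mul_le_mul_of_nonneg_left (h4.trans h5) (by positivity)
    _ = (8 * ((p : ℝ) ^ 3 * ‖ν₀‖ + (p : ℝ) ^ 2) / κ) * (ζ + a) := by ring
    _ ≤ _ := mul_le_mul_of_nonneg_right (by linarith) (by positivity)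

theorem sum_rho_sq_le {p : ℕ} (ν : Param p) : ∑ j, rho ν j ^ 2 ≤ ‖ν‖ ^ 2 := by
  rw [EuclideanSpace.norm_sq_eq, Fintype.sum_prod_type]
  refine Finset.sum_le_sum fun j _ => ?_
  refine (le_of_eq ?_).trans (Finset.single_le_sum (f := fun k => ‖ν (j, k)‖ ^ 2)
    (fun k _ => sq_nonneg _) (Finset.mem_univ j))
  simp [rho]

/-- The empty graph has the smallest penalty. -/
theorem penalty_vec_one_le {p : ℕ} {pen : ℝ → ℝ} (hmono : MonotoneOn pen (Set.Ici 0))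
    (ν : Param p) : penalty pen (vec (1 : Matrix (Fin p) (Fin p) ℝ)) ≤ penalty pen ν := by
  refine Finset.sum_le_sum fun i _ => Finset.sum_le_sum fun j _ => ?_
  by_cases hij : i = j
  · simp [hij]
  · simpa [hij, vec] using hmono (Set.mem_Ici.2 le_rfl) (Set.mem_Ici.2 (abs_nonneg (ν (i, j))))
      (abs_nonneg _)

/-- Coercivity: if `S` is close to `Σ₀`, then outside one fixed compact part of the DAG space the
likelihood is no larger than at the empty graph with unit variances. -/
theorem exists_dagBox_gaussObj_le {p : ℕ} {Sigma₀ : Matrix (Fin p) (Fin p) ℝ}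
    (hSigma : Sigma₀.PosDef) (c : Param p) :
    ∃ ζ₀ > 0, ∃ r > 0, ∃ R, vec (1 : Matrix (Fin p) (Fin p) ℝ) ∈ dagBox c r R ∧
      ∀ S : Matrix (Fin p) (Fin p) ℝ, (∀ i j, |S i j - Sigma₀ i j| ≤ ζ₀) →
      ∀ ν ∈ dagSpace p, ν ∉ dagBox c r R →
        gaussObj S ν ≤ gaussObj S (vec (1 : Matrix (Fin p) (Fin p) ℝ)) := by
  obtain ⟨κ, hκ0, hκ⟩ := exists_pos_mul_sq_le_trace hSigma
  set e : Param p := vec (1 : Matrix (Fin p) (Fin p) ℝ) with he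
  set ζ₀ : ℝ := κ / (2 * ((p : ℝ) ^ 3 + 1)) with hζ₀
  have hζ₀pos : 0 < ζ₀ := by positivity
  have hp3 : (p : ℝ) ^ 3 * ζ₀ ≤ κ / 2 := by
    calc (p : ℝ) ^ 3 * ζ₀ ≤ ((p : ℝ) ^ 3 + 1) * ζ₀ :=
          mul_le_mul_of_nonneg_right (by linarith) hζ₀pos.le
      _ = κ / 2 := by rw [hζ₀]; field_simp
  -- `T` bounds `tr S / 2 + 2 p / κ` from above: the deficit which the coercive terms must exceed.
  set T : ℝ := (1 / 2) * (|((coeffMat e).transpose * Sigma₀ * coeffMat e).trace| +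
    (p : ℝ) ^ 3 * ζ₀ * ‖e‖ * ‖e‖) + 2 * p / κ with hT
  have hT0 : 0 ≤ T := by positivity
  set ρ : ℝ := Real.exp (-T) with hρ
  set Q : ℝ := ‖c‖ + ‖e‖ + (8 * T / κ + 1) with hQ
  have hQ1 : 0 ≤ 8 * T / κ := by positivity
  have hrho : ∀ j, rho e j = 1 := fun j => by simp [he, rho, vec]
  refine ⟨ζ₀, hζ₀pos, ρ, Real.exp_pos _, Q, ⟨?_, fun j => ?_, ?_⟩, ?_⟩
  · have hadj : adj e = 0 := by
      ext i j
      by_cases h : i = j <;> simp [adj, he, vec, h]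
    intro i hi
    obtain ⟨k, -, hk⟩ := Relation.TransGen.tail'_iff.1 hi
    simp [hadj] at hk
  · rw [hrho]
    exact Real.exp_le_one_iff.2 (by linarith)
  · refine (norm_sub_le _ _).trans ?_
    rw [hQ]
    linarith
  · intro S hS ν hν hout
    have hE : ∀ i j, |(S - Sigma₀) i j| ≤ ζ₀ := hS
    have hsplit := trace_mul_mul_eq_add S Sigma₀
    have h1 : gaussObj S e ≥ -(T - 2 * p / κ) := by
      have h2 := (abs_le.1 (abs_trace_le hE e e)).2
      have h3 := le_abs_self ((coeffMat e).transpose * Sigma₀ * coeffMat e).trace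
      have h4 := hsplit (coeffMat e) (coeffMat e)
      simp only [gaussObj, hrho, Real.log_one, Finset.sum_const_zero, hT]
      linarith
    have h2 : κ / 2 * ‖ν‖ ^ 2 ≤ ((coeffMat ν).transpose * S * coeffMat ν).trace := by
      have h3 := (abs_le.1 (abs_trace_le hE ν ν)).1
      have h4 := hκ ν
      have h5 := mul_le_mul_of_nonneg_right hp3 (sq_nonneg ‖ν‖)
      rw [hsplit]
      linarith [h5, h3, h4, show (p : ℝ) ^ 3 * ζ₀ * ‖ν‖ * ‖ν‖ = (p : ℝ) ^ 3 * ζ₀ * ‖ν‖ ^ 2 by ring]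
    -- `log t ≤ t - 1 ≤ κ t² / 8 + 2 / κ`
    have hlog : ∀ t : ℝ, 0 < t → Real.log t ≤ κ / 8 * t ^ 2 + 2 / κ := by
      intro t ht
      refine (Real.log_le_sub_one_of_pos ht).trans ?_
      have h3 : κ / 8 * t ^ 2 + 2 / κ - t = κ / 8 * (t - 4 / κ) ^ 2 := by field_simp; ring
      have h4 : 0 ≤ κ / 8 * (t - 4 / κ) ^ 2 := by positivity
      linarith
    have hsq := mul_le_mul_of_nonneg_left (sum_rho_sq_le ν) (show 0 ≤ κ / 8 by positivity)
    refine le_trans ?_ h1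
    have hcase : (∃ j, rho ν j < ρ) ∨ Q < ‖ν - c‖ := by
      by_contra! h
      exact hout ⟨hν.1, h.1, h.2⟩
    rcases hcase with ⟨j, hj⟩ | hnorm
    · have h3 : Real.log (rho ν j) ≤ -T := by
        rw [Real.log_le_iff_le_exp (hν.2 j)]
        exact hj.le
      have h4 : ∑ i, Real.log (rho ν i) ≤ -T + ∑ i, (κ / 8 * rho ν i ^ 2 + 2 / κ) := by
        rw [← Finset.add_sum_erase _ _ (Finset.mem_univ j)]
        refine add_le_add h3 ?_
        refine (Finset.sum_le_sum fun i _ => hlog _ (hν.2 i)).trans ?_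
        exact Finset.sum_le_sum_of_subset_of_nonneg (Finset.erase_subset _ _)
          fun i _ _ => by positivity
      rw [Finset.sum_add_distrib, ← Finset.mul_sum] at h4
      simp only [Finset.sum_const, Finset.card_univ, Fintype.card_fin, nsmul_eq_mul] at h4
      have h5 : 0 ≤ κ / 8 * ‖ν‖ ^ 2 := by positivity
      have h6 : (p : ℝ) * (2 / κ) = 2 * p / κ := by ring
      simp only [gaussObj]
      linarith
    · have h3 : 8 * T / κ + 1 ≤ ‖ν‖ := by
        have := norm_sub_le ν c
        have := norm_nonneg e
        linarith
      have h4 : T ≤ κ / 8 * ‖ν‖ ^ 2 := by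
        have h5 : ‖ν‖ ≤ ‖ν‖ ^ 2 := by nlinarith
        have h6 : 8 * T / κ ≤ ‖ν‖ ^ 2 := by linarith
        rw [div_le_iff₀ hκ0] at h6
        linarith
      have h7 : ∑ i, Real.log (rho ν i) ≤ ∑ i, (κ / 8 * rho ν i ^ 2 + 2 / κ) :=
        Finset.sum_le_sum fun i _ => hlog _ (hν.2 i)
      rw [Finset.sum_add_distrib, ← Finset.mul_sum] at h7
      simp only [Finset.sum_const, Finset.card_univ, Fintype.card_fin, nsmul_eq_mul] at h7
      have h6 : (p : ℝ) * (2 / κ) = 2 * p / κ := by ring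
      simp only [gaussObj]
      linarith

/-! ### The estimator -/

theorem exists_measurable_isMaxOn_penLogLik {p : ℕ} {pen : ℝ → ℝ}
    (hlsc : LowerSemicontinuousOn pen (Set.Ici 0)) (n : ℕ) {c : Param p} {r R : ℝ} (hr : 0 < r)
    (hne : (dagBox c r R).Nonempty) :
    ∃ est : Matrix (Fin n) (Fin p) ℝ → Param p,
      (Measurable fun y : Fin n → Fin p → ℝ => est (Matrix.of y)) ∧
      ∀ x, est x ∈ dagBox c r R ∧ IsMaxOn (penLogLik pen n x) (dagBox c r R) (est x) := by
  obtain ⟨g, hg, hmax⟩ := exists_measurable_isMaxOn (isCompact_dagBox c r R) hne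
    (fun (y : Fin n → Fin p → ℝ) ν => penLogLik pen n (Matrix.of y) ν)
    (fun ν _ => (continuous_logLik_data n ν).sub continuous_const)
    (fun y => (upperSemicontinuousOn_penLogLik hlsc n (Matrix.of y)).mono
      (dagBox_subset_dagSpace hr))
  exact ⟨fun x => g (Matrix.of.symm x), hg, fun x => hmax (Matrix.of.symm x)⟩

/-- The deterministic core: there are measurable estimators which, as soon as the sample
second-moment matrix is within a small `ζ` of `Σ₀`, are local maximizers at distance of order
`ζ + maxSlope` from `ν₀`. They maximize the objective over a small ball around `ν₀` while the
slope is small; otherwise they maximize over a large compact set, which catches a global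
maximizer, and a bounded distance suffices. -/
theorem exists_estimator {p : ℕ} {Sigma₀ : Matrix (Fin p) (Fin p) ℝ}
    (hSigma : Sigma₀.PosDef) {q : ℕ → ℝ → ℝ} (hmono : ∀ n, MonotoneOn (q n) (Set.Ici 0))
    (hlsc : ∀ n, LowerSemicontinuousOn (q n) (Set.Ici 0))
    {ν₀ : Param p} (hν₀ : ν₀ ∈ equivClass Sigma₀⁻¹)
    (hreg : ∀ i j, adj ν₀ i j ≠ 0 → EquiC2At q |adj ν₀ i j|)
    (hb : Tendsto (fun n => maxCurvature (q n) ν₀) atTop (𝓝 0)) :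
    ∃ est : (n : ℕ) → Matrix (Fin n) (Fin p) ℝ → Param p,
      (∀ n, Measurable fun y : Fin n → Fin p → ℝ => est n (Matrix.of y)) ∧
      ∃ ζ₁ > 0, ∃ C > 0, ∀ᶠ n in atTop, ∀ x : Matrix (Fin n) (Fin p) ℝ, ∀ ζ, 0 ≤ ζ → ζ ≤ ζ₁ →
        (∀ i j, |sampleCov x i j - Sigma₀ i j| ≤ ζ) →
        IsLocalMaximizer (q n) n x (est n x) ∧
          ‖est n x - ν₀‖ ≤ C * (ζ + maxSlope (q n) ν₀) := by
  obtain ⟨M, hM, ζa, hζa, r₁, hr₁, hloc⟩ :=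
    exists_norm_sub_le_of_le hSigma hmono hν₀ hreg hb
  obtain ⟨ζb, hζb, r, hr, R, hone, hglob⟩ := exists_dagBox_gaussObj_le hSigma ν₀
  -- a radius for which the ball around `ν₀` satisfies `ρ_j ≥ r₀`
  obtain ⟨r₀, hr₀, hr₀₁, hr₀ρ⟩ : ∃ r₀ > 0, r₀ ≤ r₁ ∧ ∀ j, 2 * r₀ ≤ rho ν₀ j := by
    have h : ∀ᶠ t : ℝ in 𝓝[>] 0, ∀ j, t < rho ν₀ j / 2 := eventually_all.2 fun j =>
      nhdsWithin_le_nhds (gt_mem_nhds (half_pos (hν₀.1.2 j)))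
    have h' : ∀ᶠ t : ℝ in 𝓝[>] 0, t < r₁ := nhdsWithin_le_nhds (gt_mem_nhds hr₁)
    obtain ⟨t, ⟨ht, ht'⟩, ht0⟩ := ((h.and h').and self_mem_nhdsWithin).exists
    exact ⟨t, ht0, ht'.le, fun j => by linarith [ht j]⟩
  have hmem : ∀ ν ∈ dagSpace p, ‖ν - ν₀‖ ≤ r₀ → ν ∈ dagBox ν₀ r₀ r₀ := by
    refine fun ν hν hd => ⟨hν.1, fun j => ?_, hd⟩
    have h1 : |rho ν j - rho ν₀ j| ≤ r₀ := (abs_coord_le_norm (ν - ν₀) (j, j)).trans hd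
    linarith [(abs_le.1 h1).1, hr₀ρ j]
  have hν₀mem : ν₀ ∈ dagBox ν₀ r₀ r₀ := hmem ν₀ hν₀.1 (by simpa using hr₀.le)
  have hR : 0 ≤ R := (norm_nonneg _).trans hone.2.2
  set δ : ℝ := r₀ / (2 * M) with hδ
  have hδ0 : 0 < δ := by positivity
  have hest : ∀ n, ∃ est : Matrix (Fin n) (Fin p) ℝ → Param p,
      (Measurable fun y : Fin n → Fin p → ℝ => est (Matrix.of y)) ∧
      (maxSlope (q n) ν₀ < δ → ∀ x, est x ∈ dagBox ν₀ r₀ r₀ ∧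
        IsMaxOn (penLogLik (q n) n x) (dagBox ν₀ r₀ r₀) (est x)) ∧
      (δ ≤ maxSlope (q n) ν₀ → ∀ x, est x ∈ dagBox ν₀ r R ∧
        IsMaxOn (penLogLik (q n) n x) (dagBox ν₀ r R) (est x)) := by
    intro n
    rcases lt_or_ge (maxSlope (q n) ν₀) δ with h | h
    · obtain ⟨est, h1, h2⟩ := exists_measurable_isMaxOn_penLogLik (hlsc n) n hr₀ ⟨ν₀, hν₀mem⟩
      exact ⟨est, h1, fun _ => h2, fun h' => absurd h h'.not_gt⟩
    · obtain ⟨est, h1, h2⟩ := exists_measurable_isMaxOn_penLogLik (hlsc n) n hr ⟨_, hone⟩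
      exact ⟨est, h1, fun h' => absurd h' h.not_gt, fun _ => h2⟩
  choose est hestm hsmall hlarge using hest
  refine ⟨est, hestm, min (min ζa ζb) (r₀ / (4 * M)), by positivity, M + R / δ, by positivity, ?_⟩
  filter_upwards [hloc, eventually_gt_atTop 0] with n hn hn0 x ζ hζ0 hζ hS
  have hζ1 : ζ ≤ ζa := hζ.trans ((min_le_left _ _).trans (min_le_left _ _))
  have hζ2 : ζ ≤ ζb := hζ.trans ((min_le_left _ _).trans (min_le_right _ _))
  have hζ3 : ζ ≤ r₀ / (4 * M) := hζ.trans (min_le_right _ _)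
  have hn0' : (0 : ℝ) < n := Nat.cast_pos.2 hn0
  have ha0 := maxSlope_nonneg (q n) ν₀
  rcases lt_or_ge (maxSlope (q n) ν₀) δ with h | h
  · obtain ⟨hx, hmax⟩ := hsmall n h x
    have hD := dagBox_subset_dagSpace hr₀ hx
    have hle := hmax hν₀mem
    simp only [Set.mem_ofPred_eq] at hle
    rw [penLogLik_eq hn0, penLogLik_eq hn0] at hle
    have hd := hn (sampleCov x) (isSymm_sampleCov x) ζ hζ0 hζ1 hS _ hD (hx.2.2.trans hr₀₁)
      (le_of_mul_le_mul_left hle hn0')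
    have hlt : ‖est n x - ν₀‖ < r₀ := by
      have h1 : M * ζ ≤ r₀ / 4 := by
        calc M * ζ ≤ M * (r₀ / (4 * M)) := mul_le_mul_of_nonneg_left hζ3 hM.le
          _ = r₀ / 4 := by field_simp
      have h2 : M * maxSlope (q n) ν₀ < r₀ / 2 := by
        calc M * maxSlope (q n) ν₀ < M * δ := mul_lt_mul_of_pos_left h hM
          _ = r₀ / 2 := by rw [hδ]; field_simp
      linarith
    refine ⟨⟨hD, ?_⟩, hd.trans (mul_le_mul_of_nonneg_right ?_ (by positivity))⟩
    · have hnear : ∀ᶠ ν in 𝓝 (est n x), ‖ν - ν₀‖ < r₀ :=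
        (Continuous.tendsto (by fun_prop) (est n x)).eventually (gt_mem_nhds hlt)
      filter_upwards [nhdsWithin_le_nhds hnear, self_mem_nhdsWithin] with ν hν hνD
      exact hmax (hmem ν hνD hν.le)
    · have : 0 ≤ R / δ := by positivity
      linarith
  · obtain ⟨hx, hmax⟩ := hlarge n h x
    have hD := dagBox_subset_dagSpace hr hx
    refine ⟨⟨hD, IsMaxOn.localize fun ν hν => ?_⟩, hx.2.2.trans ?_⟩
    · by_cases hbox : ν ∈ dagBox ν₀ r R
      · exact hmax hbox
      · have hmax_one : penLogLik (q n) n x (vec 1) ≤ penLogLik (q n) n x (est n x) := hmax hone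
        refine le_trans ?_ hmax_one
        rw [penLogLik_eq hn0, penLogLik_eq hn0]
        refine mul_le_mul_of_nonneg_left (sub_le_sub ?_ (penalty_vec_one_le (hmono n) ν)) hn0'.le
        exact hglob _ (fun i j => (hS i j).trans hζ2) ν hν hbox
    · calc R = R / δ * δ := by field_simp
        _ ≤ R / δ * maxSlope (q n) ν₀ := mul_le_mul_of_nonneg_left h (by positivity)
        _ ≤ (M + R / δ) * (ζ + maxSlope (q n) ν₀) :=
          mul_le_mul (by linarith) (by linarith) ha0 (by positivity)

theorem theorem1 (p : ℕ) (hp : 1 ≤ p)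
    -- the true covariance matrix
    (Sigma₀ : Matrix (Fin p) (Fin p) ℝ) (hSigma : Sigma₀.PosDef)
    -- i.i.d. observations from the centred Gaussian distribution with covariance `Sigma₀`
    {Ω : Type*} [MeasurableSpace Ω] (P : Measure Ω) [IsProbabilityMeasure P]
    (X : ℕ → Ω → EuclideanSpace ℝ (Fin p))
    (hlaw : ∀ k, HasLaw (X k) (multivariateGaussian 0 Sigma₀) P)
    (hindep : iIndepFun X P)
    -- the penalty functions `pen l` on `[0, ∞)`, with tuning parameters `l`, and the tuning sequence
    {Λ : Type*} (pen : Λ → ℝ → ℝ) (lam : ℕ → Λ)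
    (hnonneg : ∀ l, ∀ t, 0 ≤ t → 0 ≤ pen l t)
    (hmono : ∀ l, MonotoneOn (pen l) (Set.Ici 0))
    (hlsc : ∀ l, LowerSemicontinuousOn (pen l) (Set.Ici 0))
    -- an equivalent DAG
    (ν₀ : Param p) (hν₀ : ν₀ ∈ equivClass Sigma₀⁻¹)
    -- the second derivatives exist near, and are equicontinuous at, the nonzero coefficients
    (hreg : ∀ i j, adj ν₀ i j ≠ 0 → EquiC2At (fun n => pen (lam n)) |adj ν₀ i j|)
    (hb : Tendsto (fun n => maxCurvature (pen (lam n)) ν₀) atTop (𝓝 0)) :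
    -- the local maximizer is a measurable function of the data
    ∃ est : (n : ℕ) → Matrix (Fin n) (Fin p) ℝ → Param p,
      (∀ n, Measurable fun y : Fin n → Fin p → ℝ => est n (Matrix.of y)) ∧
      Tendsto (fun n => P {ω | ¬ IsLocalMaximizer (pen (lam n)) n (dataMatrix X n ω)
        (est n (dataMatrix X n ω))}) atTop (𝓝 0) ∧
      IsBigOP P (fun n ω => est n (dataMatrix X n ω) - ν₀)
        (fun n => (n : ℝ) ^ (-(1 / 2) : ℝ) + maxSlope (pen (lam n)) ν₀) := by
  obtain ⟨est, hmeas, ζ₁, hζ₁, C, hC, hest⟩ := exists_estimator hSigma (fun n => hmono (lam n))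
    (fun n => hlsc (lam n)) hν₀ hreg hb
  obtain ⟨V, hV, hcheb⟩ := exists_measure_sampleCov_sub_le hSigma.posSemidef P X hlaw hindep
  have hsmall : ∀ (n : ℕ) (ω : Ω) (ζ : ℝ),
      ω ∉ {ω | ∃ i j, ζ ≤ |sampleCov (dataMatrix X n ω) i j - Sigma₀ i j|} →
      ∀ i j, |sampleCov (dataMatrix X n ω) i j - Sigma₀ i j| ≤ ζ := by
    intro n ω ζ h i j
    by_contra hlt
    exact h ⟨i, j, (not_le.1 hlt).le⟩
  refine ⟨est, hmeas, ?_, fun ε hε => ?_⟩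
  · have hlim : Tendsto (fun n : ℕ => ENNReal.ofReal (V / (n * ζ₁ ^ 2))) atTop (𝓝 0) := by
      rw [← ENNReal.ofReal_zero]
      exact ENNReal.tendsto_ofReal (tendsto_const_nhds.div_atTop
        (tendsto_natCast_atTop_atTop.atTop_mul_const (by positivity)))
    refine tendsto_of_tendsto_of_tendsto_of_le_of_le' tendsto_const_nhds hlim
      (Eventually.of_forall fun _ => zero_le) ?_
    filter_upwards [hest, eventually_gt_atTop 0] with n hn hn0
    refine (measure_mono fun ω hω => ?_).trans (hcheb n hn0 ζ₁ hζ₁)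
    by_contra hgood
    exact hω (hn _ ζ₁ hζ₁.le le_rfl (hsmall n ω ζ₁ hgood)).1
  · -- Chebyshev's bound at the scale `c n^(-1/2)` is `V / c² ≤ ε`.
    set c : ℝ := Real.sqrt (V / ε) + 1 with hc
    have hc0 : 0 < c := by positivity
    have hcV : V / c ^ 2 ≤ ε := by
      have h1 : V / ε ≤ c ^ 2 := by
        rw [← Real.sq_sqrt (div_nonneg hV hε.le)]
        exact pow_le_pow_left₀ (Real.sqrt_nonneg _) (by linarith) 2
      rw [div_le_iff₀ (by positivity)]
      rw [div_le_iff₀ hε] at h1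
      linarith
    refine ⟨C * (c + 1), by positivity, ?_⟩
    have hlim : Tendsto (fun n : ℕ => c * (n : ℝ) ^ (-(1 / 2) : ℝ)) atTop (𝓝 0) := by
      simpa using ((tendsto_rpow_neg_atTop (show (0 : ℝ) < 1 / 2 by norm_num)).comp
        tendsto_natCast_atTop_atTop).const_mul c
    filter_upwards [hest, eventually_gt_atTop 0, hlim.eventually (ge_mem_nhds hζ₁)]
      with n hn hn0 hnζ
    have hn0' : (0 : ℝ) < n := Nat.cast_pos.2 hn0
    set s : ℝ := (n : ℝ) ^ (-(1 / 2) : ℝ) with hs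
    have hs0 : 0 < s := Real.rpow_pos_of_pos hn0' _
    have hs2 : (n : ℝ) * (c * s) ^ 2 = c ^ 2 := by
      have : s ^ 2 = (n : ℝ)⁻¹ := by
        rw [hs, ← Real.rpow_natCast, ← Real.rpow_mul hn0'.le, ← Real.rpow_neg_one]
        norm_num
      rw [mul_pow, this]
      field_simp
    have hbound := hcheb n hn0 (c * s) (by positivity)
    rw [hs2] at hbound
    refine (measure_mono fun ω hω => ?_).trans (hbound.trans (ENNReal.ofReal_le_ofReal hcV))
    by_contra hgood
    refine absurd (hn _ (c * s) (by positivity) hnζ (hsmall n ω _ hgood)).2 (not_le.2 ?_)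
    refine lt_of_le_of_lt ?_ hω
    have ha := maxSlope_nonneg (pen (lam n)) ν₀
    rw [mul_assoc]
    refine mul_le_mul_of_nonneg_left ?_ hC.le
    have := mul_nonneg hc0.le ha
    linarith
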